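/- **Proposition 7.8** (no simultaneous isometric and almost sure Skorokhod representation). Throughout, $|x|_p=(\sum_i|x_i|^p)^{1/p}$ is the $p$-norm on $\mathbb R^2$, $\mathcal P_p(\mathbb R^2)$ is the set of Borel probability measures on $\mathbb R^2$ with finite $p$-th moment, and $$\mathcal W_p(\mu,\nu)=\inf_{\pi}\Big\{\int|x-y|_p^p\,\pi(dx,dy)\Big\}^{1/p},$$ the infimum running over all couplings $\pi$ of $\mu$ and $\nu$. A stochastic basis with $N=2$ time periods is a filtered probability space $(\Omega,\mathcal F,\mathbb P,(\mathcal F_t)_{t=1}^2)$; a real-valued filtered process $\mathbb X=(\Omega,\mathcal F,\mathbb P,(\mathcal F_t)_{t=1}^2,(X_t)_{t=1}^2)$ is a stochastic basis together with a real-valued adapted process, and its $p$-th moment is $\mathbb E[|X|_p^p]$, where $X=(X_1,X_2)$. For filtered processes $\mathbb X,\mathbb Y$, a coupling $\pi$ of $\mathbb P^{\mathbb X}$ and $\mathbb P^{\mathbb Y}$ is *bicausal* if for $t=1,2$, under $\pi$, $\mathcal F^{\mathbb X}_2$ and $\mathcal F^{\mathbb Y}_t$ are conditionally independent given $\mathcal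 F^{\mathbb X}_t$, and $\mathcal F^{\mathbb Y}_2$ and $\mathcal F^{\mathbb X}_t$ are conditionally independent given $\mathcal F^{\mathbb Y}_t$ (all σ-algebras lifted to the product space). The adapted Wasserstein distance is $$\mathcal{AW}_p(\mathbb X,\mathbb Y)=\inf_{\pi\text{ bicausal}}\big\{\mathbb E_\pi[|X-Y|_p^p]\big\}^{1/p}.$$ The *adapted functions* are the smallest class of formal expressions containing every bounded continuous function $\Phi$ of the path, with value $\Phi(X)$, and closed under forming $\varphi(f_1,\dots,f_k)$ with $\varphi:\mathbb R^k\to\mathbb R$ bounded and continuous, and under $f\mapsto\mathbb E[f\mid\mathcal F_t]$ for each $t$. Two filtered processes are *Hoover–Keisler equivalent*, $\mathbb X\sim_{\mathrm{HK}}\mathbb Y$, if each adapted function has the same expectation when evaluated at $\mathbb X$ and at $\mathbb Y$. For every $p\in[1,\infty)$ the following hold. (i) There exist $\mu,\mu^1,\mu^2,\ldots\in\mathcal P_p(\mathbb R^2)$ with $\mathcal W_p(\mu^n,\mu)\to0$ such that there is no probability space $(\Omega,\mathcal F,\mathbb P)$ with random variables $X\sim\mu$ and $X^n\sim\mu^n$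 ($n\ge1$) satisfying both $\mathbb E_{\mathbb P}[|X^n-X|_p^p]=\mathcal W_p^p(\mu^n,\mu)$ for all $n$ and $X^n\to X$ $\mathbb P$-almost surely. (ii) There exist real-valued filtered processes $\mathbb X,\mathbb X^1,\mathbb X^2,\ldots$ with $N=2$ time periods and finite $p$-th moments, with $\mathcal{AW}_p(\mathbb X^n,\mathbb X)\to0$, such that there is no stochastic basis $(\Omega,\mathcal F,\mathbb P,(\mathcal F_t)_{t=1}^2)$ with adapted real-valued processes $(X_t)_{t=1}^2$ and $(X^n_t)_{t=1}^2$ ($n\ge1$) satisfying $$(\Omega,\mathcal F,\mathbb P,(\mathcal F_t)_{t=1}^2,X^n)\sim_{\mathrm{HK}}\mathbb X^n\ \text{ for all }n,\qquad(\Omega,\mathcal F,\mathbb P,(\mathcal F_t)_{t=1}^2,X)\sim_{\mathrm{HK}}\mathbb X,$$ $\mathbb E_{\mathbb P}[|X^n-X|_p^p]=\mathcal{AW}_p^p(\mathbb X^n,\mathbb X)$ for all $n$, and $X^n\to X$ $\mathbb P$-almost surely. -/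

import Mathlib

open MeasureTheory Filter Topology
open scoped ENNReal BoundedContinuousFunction

universe u v

noncomputable section

namespace AdaptedTransport

/-! ### Classical Wasserstein distance -/

/-- The `p`-norm on `ℝ^ι`. -/
def pNorm {ι : Type*} [Fintype ι] (p : ℝ) (x : ι → ℝ) : ℝ :=
  (∑ i, |x i| ^ p) ^ (1 / p)

/-- The moment `E[|X - Y|_p ^ p]`, as an extended nonnegative number. -/
def cost {ι : Type*} [Fintype ι] {Ω : Type*} [MeasurableSpace Ω] (p : ℝ) (P : Measure Ω)
    (X Y : Ω → ι → ℝ) : ℝ≥0∞ :=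
  ∫⁻ ω, ENNReal.ofReal (pNorm p (X ω - Y ω) ^ p) ∂P

/-- `μ` is a Borel probability measure on `ℝ^ι` with finite `p`-th moment. -/
structure MemPp {ι : Type*} [Fintype ι] (p : ℝ) (μ : Measure (ι → ℝ)) : Prop where
  isProbability : IsProbabilityMeasure μ
  moment : ∫⁻ x, ENNReal.ofReal (pNorm p x ^ p) ∂μ < ∞

/-- `π` is a coupling of `μ` and `ν`. -/
structure IsCoupling {α β : Type*} [MeasurableSpace α] [MeasurableSpace β]
    (μ : Measure α) (ν : Measure β) (π : Measure (α × β)) : Prop where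
  fst : π.map Prod.fst = μ
  snd : π.map Prod.snd = ν

/-- The `p`-th power of the `p`-Wasserstein distance on `ℝ^ι` with the `p`-norm. -/
def wassersteinPow {ι : Type*} [Fintype ι] (p : ℝ) (μ ν : Measure (ι → ℝ)) : ℝ≥0∞ :=
  ⨅ (π : Measure ((ι → ℝ) × (ι → ℝ))) (_ : IsCoupling μ ν π), cost p π Prod.fst Prod.snd

/-- The `p`-Wasserstein distance on `ℝ^ι` with the `p`-norm. -/
def wasserstein {ι : Type*} [Fintype ι] (p : ℝ) (μ ν : Measure (ι → ℝ)) : ℝ≥0∞ :=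
  wassersteinPow p μ ν ^ (1 / p)

/-! ### Filtered processes -/

/-- A stochastic basis with `N` time periods; the times `1, …, N` are indexed by `Fin N`. -/
structure StochasticBasis (N : ℕ) : Type (u + 1) where
  /-- The sample space. -/
  Ω : Type u
  /-- The ambient σ-algebra. -/
  [measurableSpace : MeasurableSpace Ω]
  /-- The probability measure. -/
  P : Measure Ω
  [isProbability : IsProbabilityMeasure P]
  /-- The filtration. -/
  ℱ : Filtration (Fin N) measurableSpace

attribute [instance] StochasticBasis.measurableSpace StochasticBasis.isProbability

/-- A real-valued filtered process with `N` time periods. -/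
structure FilteredProcess (N : ℕ) : Type (u + 1) where
  /-- The stochastic basis. -/
  basis : StochasticBasis.{u} N
  /-- The process. -/
  X : Fin N → basis.Ω → ℝ
  adapted : Adapted basis.ℱ X

/-- The path of a process. -/
def pathOf {N : ℕ} {Ω : Type*} (X : Fin N → Ω → ℝ) (ω : Ω) : Fin N → ℝ := fun t => X t ω

/-- Finite `p`-th moment. -/
def FilteredProcess.HasMoment {N : ℕ} (p : ℝ) (𝕏 : FilteredProcess.{u} N) : Prop :=
  ∫⁻ ω, ENNReal.ofReal (pNorm p (pathOf 𝕏.X ω) ^ p) ∂𝕏.basis.P < ∞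

/-! ### Hoover–Keisler equivalence -/

/-- The adapted functions (conditional processes) of Hoover and Keisler: bounded continuous
functions of the path, closed under composition with bounded continuous functions and under
conditional expectation given the information at a time `t`. -/
inductive AdaptedFunction (N : ℕ) : Type
  | base (Φ : (Fin N → ℝ) →ᵇ ℝ) : AdaptedFunction N
  | comp {n : ℕ} (φ : (Fin n → ℝ) →ᵇ ℝ) (f : Fin n → AdaptedFunction N) : AdaptedFunction N
  | cond (t : Fin N) (f : AdaptedFunction N) : AdaptedFunction N

/-- The random variable obtained by evaluating an adapted function at a filtered process. -/
def AdaptedFunction.eval {N : ℕ} (𝕏 : FilteredProcess.{u} N) :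
    AdaptedFunction N → 𝕏.basis.Ω → ℝ
  | base Φ => fun ω => Φ (pathOf 𝕏.X ω)
  | comp φ f => fun ω => φ (fun i => (f i).eval 𝕏 ω)
  | cond t f => 𝕏.basis.P[f.eval 𝕏 | 𝕏.basis.ℱ t]

/-- Hoover–Keisler equivalence: all adapted functions have the same expectation. -/
def HKEquiv {N : ℕ} (𝕏 : FilteredProcess.{u} N) (𝕐 : FilteredProcess.{v} N) : Prop :=
  ∀ f : AdaptedFunction N,
    ∫ ω, f.eval 𝕏 ω ∂𝕏.basis.P = ∫ ω, f.eval 𝕐 ω ∂𝕐.basis.P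

/-! ### Adapted Wasserstein distance -/

/-- The σ-algebras `m₁` and `m₂` are conditionally independent given `m'` under `μ`. -/
def CondIndepGiven {Ω : Type*} {m : MeasurableSpace Ω} (μ : Measure Ω)
    (m₁ m₂ m' : MeasurableSpace Ω) : Prop :=
  ∀ s t : Set Ω, MeasurableSet[m₁] s → MeasurableSet[m₂] t →
    μ[(s ∩ t).indicator (fun _ => (1 : ℝ)) | m'] =ᵐ[μ]
      μ[s.indicator (fun _ => (1 : ℝ)) | m'] * μ[t.indicator (fun _ => (1 : ℝ)) | m']

/-- Bicausal couplings of two stochastic bases. Since the filtrations are increasing,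
`⨆ s, ℱ s` is the σ-algebra at the terminal time. -/
structure IsBicausal {N : ℕ} (A : StochasticBasis.{u} N) (B : StochasticBasis.{v} N)
    (π : Measure (A.Ω × B.Ω)) : Prop where
  coupling : IsCoupling A.P B.P π
  /-- Causality from the first basis to the second. -/
  causal_fst : ∀ t : Fin N, CondIndepGiven π ((⨆ s, A.ℱ s).comap Prod.fst)
    ((B.ℱ t).comap Prod.snd) ((A.ℱ t).comap Prod.fst)
  /-- Causality from the second basis to the first. -/
  causal_snd : ∀ t : Fin N, CondIndepGiven π ((⨆ s, B.ℱ s).comap Prod.snd)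
    ((A.ℱ t).comap Prod.fst) ((B.ℱ t).comap Prod.snd)

/-- The `p`-th power of the adapted Wasserstein distance. -/
def adaptedWassersteinPow {N : ℕ} (p : ℝ) (𝕏 : FilteredProcess.{u} N)
    (𝕐 : FilteredProcess.{v} N) : ℝ≥0∞ :=
  ⨅ (π : Measure (𝕏.basis.Ω × 𝕐.basis.Ω)) (_ : IsBicausal 𝕏.basis 𝕐.basis π),
    cost p π (fun ω => pathOf 𝕏.X ω.1) (fun ω => pathOf 𝕐.X ω.2)

/-- The adapted Wasserstein distance. -/
def adaptedWasserstein {N : ℕ} (p : ℝ) (𝕏 : FilteredProcess.{u} N)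
    (𝕐 : FilteredProcess.{v} N) : ℝ≥0∞ :=
  adaptedWassersteinPow p 𝕏 𝕐 ^ (1 / p)

end AdaptedTransport

end

namespace AdaptedTransport

/-! ### The typewriter sets -/

/-! Let `U` be uniform on `[0, 1)` and compare the laws of `(U, 1_A(U))`, for `A` running through
the typewriter sets, with the law of `(U, 0)`. Keeping `U` fixed costs exactly the mass of `A`,
which tends to zero. Any coupling already pays this mass for the vertical displacement, so an
optimal one cannot move the first coordinate (`ae_eq_of_cost_le`). On a common space all the first
coordinates thus coincide almost surely with a single uniform variable, and the second ones are its
typewriter indicators. Each point of `[0, 1)` lies in infinitely many of these sets, so almost sure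
convergence to zero fails (`not_ae_tendsto_of_cost_le`). The adapted statement reduces to the same
contradiction: if everything is known at the first time, the diagonal coupling is bicausal and gives
the same upper bound, while Hoover–Keisler equivalence fixes the path laws. -/

/-- The typewriter sequence of intervals: for `n = k ^ 2 + j` with `0 ≤ j ≤ 2 * k`, the interval
`[j / (k + 1), (j + 1) / (k + 1))`. -/
def typewriterSet (n : ℕ) : Set ℝ :=
  Set.Ico (((n - n.sqrt ^ 2 : ℕ) : ℝ) / (n.sqrt + 1))
    ((((n - n.sqrt ^ 2 : ℕ) : ℝ) + 1) / (n.sqrt + 1))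

lemma measurableSet_typewriterSet (n : ℕ) : MeasurableSet (typewriterSet n) :=
  measurableSet_Ico

lemma volume_typewriterSet (n : ℕ) :
    volume (typewriterSet n) = ENNReal.ofReal (1 / ((n.sqrt : ℝ) + 1)) := by
  rw [typewriterSet, Real.volume_Ico]
  congr 1
  ring

lemma tendsto_volume_typewriterSet :
    Tendsto (fun n => volume (typewriterSet n)) atTop (𝓝 0) := by
  simp_rw [volume_typewriterSet]
  have hsqrt : Tendsto Nat.sqrt atTop atTop :=
    tendsto_atTop.2 fun b => eventually_atTop.2 ⟨b * b, fun n hn => Nat.le_sqrt.2 hn⟩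
  have h := (tendsto_one_div_add_atTop_nhds_zero_nat (𝕜 := ℝ)).comp hsqrt
  simpa [Function.comp_def] using ENNReal.tendsto_ofReal h

/-- For each `k`, the intervals with `j ≤ k` tile `[0, 1)`, so every block contains an index that
hits `x`. Those with `j > k` lie to the right of `[0, 1)` and do no harm. -/
lemma frequently_mem_typewriterSet {x : ℝ} (hx : x ∈ Set.Ico (0 : ℝ) 1) :
    ∃ᶠ n in atTop, x ∈ typewriterSet n := by
  refine frequently_atTop.2 fun k => ?_
  have hk : (0 : ℝ) < (k : ℝ) + 1 := by positivity
  have h0 : 0 ≤ x * (k + 1) := mul_nonneg hx.1 hk.le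
  set j := ⌊x * (k + 1)⌋₊ with hj
  have hjk : j < k + 1 := by
    rw [hj, Nat.floor_lt h0]
    push_cast
    nlinarith [hx.2]
  -- The index stays in block `k` because `j ≤ k ≤ 2 * k`.
  have hs : (k ^ 2 + j).sqrt = k := by
    rw [pow_two]
    exact Nat.sqrt_add_eq k (by omega)
  refine ⟨k ^ 2 + j, by nlinarith, ?_⟩
  rw [typewriterSet, hs, Nat.add_sub_cancel_left, Set.mem_Ico, div_le_iff₀ hk, lt_div_iff₀ hk]
  exact ⟨Nat.floor_le h0, Nat.lt_floor_add_one _⟩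

/-! ### The transport cost in the plane -/

lemma ofReal_pNorm_rpow {p : ℝ} (hp : 0 < p) (x : Fin 2 → ℝ) :
    ENNReal.ofReal (pNorm p x ^ p) =
      ENNReal.ofReal (|x 0| ^ p) + ENNReal.ofReal (|x 1| ^ p) := by
  have h0 : 0 ≤ |x 0| ^ p := by positivity
  have h1 : 0 ≤ |x 1| ^ p := by positivity
  rw [pNorm, Fin.sum_univ_two, ← Real.rpow_mul (add_nonneg h0 h1), one_div_mul_cancel hp.ne',
    Real.rpow_one, ENNReal.ofReal_add h0 h1]

lemma measurable_ofReal_pNorm_rpow {ι : Type*} [Fintype ι] (p : ℝ) :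
    Measurable fun x : ι → ℝ => ENNReal.ofReal (pNorm p x ^ p) := by
  unfold pNorm
  fun_prop

lemma cost_eq_add {Ω : Type*} [MeasurableSpace Ω] {p : ℝ} (hp : 0 < p) (P : Measure Ω)
    {X Y : Ω → Fin 2 → ℝ} (hX : Measurable X) (hY : Measurable Y) :
    cost p P X Y = ∫⁻ ω, ENNReal.ofReal (|X ω 0 - Y ω 0| ^ p) ∂P +
      ∫⁻ ω, ENNReal.ofReal (|X ω 1 - Y ω 1| ^ p) ∂P := by
  simp_rw [cost, ofReal_pNorm_rpow hp]
  exact lintegral_add_left (by fun_prop) _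

lemma cost_map {ι Ω Ω' : Type*} [Fintype ι] [MeasurableSpace Ω] [MeasurableSpace Ω'] (p : ℝ)
    (P : Measure Ω) {f : Ω → Ω'} (hf : Measurable f) {X Y : Ω' → ι → ℝ}
    (hX : Measurable X) (hY : Measurable Y) :
    cost p (P.map f) X Y = cost p P (X ∘ f) (Y ∘ f) :=
  lintegral_map ((measurable_ofReal_pNorm_rpow p).comp (hX.sub hY)) hf

/-! ### Graphs of indicator functions over a uniform variable -/

/-- The uniform distribution on `[0, 1)`. -/
noncomputable def uniformUnit : Measure ℝ := volume.restrict (Set.Ico 0 1)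

instance : IsProbabilityMeasure uniformUnit := ⟨by simp [uniformUnit]⟩

lemma uniformUnit_le (A : Set ℝ) : uniformUnit A ≤ volume A := Measure.restrict_apply_le _ _

/-- The point of the graph of the indicator function of `A` above `x`. -/
noncomputable def graphPath (A : Set ℝ) (x : ℝ) : Fin 2 → ℝ := ![x, A.indicator 1 x]

@[simp] lemma graphPath_zero (A : Set ℝ) (x : ℝ) : graphPath A x 0 = x := rfl

@[simp] lemma graphPath_one (A : Set ℝ) (x : ℝ) : graphPath A x 1 = A.indicator 1 x := rfl

lemma measurable_graphPath {A : Set ℝ} (hA : MeasurableSet A) : Measurable (graphPath A) := by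
  refine measurable_pi_lambda _ fun i => ?_
  fin_cases i
  · exact measurable_id
  · exact measurable_one.indicator hA

/-- The distribution of `(U, 1_A(U))` for `U` uniform on `[0, 1)`. -/
noncomputable def graphLaw (A : Set ℝ) : Measure (Fin 2 → ℝ) := uniformUnit.map (graphPath A)

lemma isProbabilityMeasure_graphLaw {A : Set ℝ} (hA : MeasurableSet A) :
    IsProbabilityMeasure (graphLaw A) :=
  Measure.isProbabilityMeasure_map (measurable_graphPath hA).aemeasurable

lemma ofReal_abs_indicator_rpow {p : ℝ} (hp : 0 < p) (A : Set ℝ) (x : ℝ) :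
    ENNReal.ofReal (|A.indicator 1 x| ^ p) = A.indicator 1 x := by
  by_cases h : x ∈ A <;> simp [h, hp.ne']

lemma lintegral_graphPath_lt_top {p : ℝ} (hp : 0 < p) (A : Set ℝ) :
    ∫⁻ x, ENNReal.ofReal (pNorm p (graphPath A x) ^ p) ∂uniformUnit < ∞ := by
  have hle : ∫⁻ x, ENNReal.ofReal (pNorm p (graphPath A x) ^ p) ∂uniformUnit ≤
      ∫⁻ _, 2 ∂uniformUnit := by
    refine setLIntegral_mono measurable_const fun x hx => ?_
    rw [ofReal_pNorm_rpow hp, graphPath_zero, graphPath_one, ofReal_abs_indicator_rpow hp,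
      ← one_add_one_eq_two]
    refine add_le_add (ENNReal.ofReal_le_one.2 ?_) (Set.indicator_le_self' (by simp) x)
    exact Real.rpow_le_one (abs_nonneg x) (by rw [abs_of_nonneg hx.1]; exact hx.2.le) hp.le
  exact hle.trans_lt (by simp)

lemma memPp_graphLaw {p : ℝ} (hp : 0 < p) {A : Set ℝ} (hA : MeasurableSet A) :
    MemPp p (graphLaw A) where
  isProbability := isProbabilityMeasure_graphLaw hA
  moment := by
    rw [graphLaw, lintegral_map (measurable_ofReal_pNorm_rpow p) (measurable_graphPath hA)]
    exact lintegral_graphPath_lt_top hp A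

lemma cost_graphPath {p : ℝ} (hp : 0 < p) {A : Set ℝ} (hA : MeasurableSet A) :
    cost p uniformUnit (graphPath A) (graphPath ∅) = uniformUnit A := by
  rw [cost_eq_add hp _ (measurable_graphPath hA) (measurable_graphPath .empty)]
  simp [hp.ne', ofReal_abs_indicator_rpow hp, lintegral_indicator_one hA]

/-- Both paths are driven by the same `U`. Only this upper bound on the distance is needed, never
its exact value. -/
lemma wassersteinPow_graphLaw_le {p : ℝ} (hp : 0 < p) {A : Set ℝ} (hA : MeasurableSet A) :
    wassersteinPow p (graphLaw A) (graphLaw ∅) ≤ uniformUnit A := by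
  have h1 := measurable_graphPath hA
  have h0 := measurable_graphPath MeasurableSet.empty
  have hcoupling : IsCoupling (graphLaw A) (graphLaw ∅)
      (uniformUnit.map fun x => (graphPath A x, graphPath ∅ x)) :=
    ⟨Measure.map_map measurable_fst (h1.prodMk h0), Measure.map_map measurable_snd (h1.prodMk h0)⟩
  refine (iInf₂_le _ hcoupling).trans ?_
  rw [cost_map p _ (h1.prodMk h0) measurable_fst measurable_snd]
  exact (cost_graphPath hp hA).le

lemma tendsto_rpow_of_le_volume_typewriterSet {p : ℝ} (hp : 0 < p) {c : ℕ → ℝ≥0∞}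
    (hc : ∀ n, c n ≤ uniformUnit (typewriterSet n)) :
    Tendsto (fun n => c n ^ (1 / p)) atTop (𝓝 0) := by
  have h : Tendsto c atTop (𝓝 0) :=
    tendsto_of_tendsto_of_tendsto_of_le_of_le tendsto_const_nhds tendsto_volume_typewriterSet
      (fun _ => zero_le) fun n => (hc n).trans (uniformUnit_le _)
  simpa [hp] using h.ennrpow_const (1 / p)

/-- The second coordinate of a variable with law `graphLaw A` is the indicator of `A` evaluated
at the first one. -/
lemma ae_eq_indicator_of_map_eq {Ω : Type*} [MeasurableSpace Ω] {P : Measure Ω}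
    {X : Ω → Fin 2 → ℝ} (hX : Measurable X) {A : Set ℝ} (hA : MeasurableSet A)
    (h : P.map X = graphLaw A) : ∀ᵐ ω ∂P, X ω 1 = A.indicator 1 (X ω 0) := by
  have hm : MeasurableSet {x : Fin 2 → ℝ | x 1 = A.indicator 1 (x 0)} :=
    measurableSet_eq_fun (by fun_prop) ((measurable_one.indicator hA).comp (by fun_prop))
  refine (ae_map_iff hX.aemeasurable hm).1 ?_
  rw [h, graphLaw, ae_map_iff (measurable_graphPath hA).aemeasurable hm]
  exact ae_of_all _ fun _ => rfl

/-- Vertical displacement is unavoidable, so a coupling of `graphLaw A` and `graphLaw ∅` whose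
cost is at most the mass of `A` has no horizontal displacement. -/
lemma ae_eq_of_cost_le {Ω : Type*} [MeasurableSpace Ω] {P : Measure Ω} {p : ℝ} (hp : 0 < p)
    {X Y : Ω → Fin 2 → ℝ} (hX : Measurable X) (hY : Measurable Y) {A : Set ℝ}
    (hA : MeasurableSet A) (hXA : P.map X = graphLaw A) (hY0 : P.map Y = graphLaw ∅)
    (h : cost p P X Y ≤ uniformUnit A) : ∀ᵐ ω ∂P, X ω 0 = Y ω 0 := by
  have hvert : ∫⁻ ω, ENNReal.ofReal (|X ω 1 - Y ω 1| ^ p) ∂P = uniformUnit A := by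
    have hm : Measurable fun x : Fin 2 → ℝ => ENNReal.ofReal (|x 1| ^ p) := by fun_prop
    calc ∫⁻ ω, ENNReal.ofReal (|X ω 1 - Y ω 1| ^ p) ∂P
        = ∫⁻ ω, ENNReal.ofReal (|X ω 1| ^ p) ∂P := by
          refine lintegral_congr_ae ?_
          filter_upwards [ae_eq_indicator_of_map_eq hY .empty hY0] with ω hω
          simp [hω]
      _ = ∫⁻ x, ENNReal.ofReal (|graphPath A x 1| ^ p) ∂uniformUnit := by
          rw [← lintegral_map hm hX, hXA, graphLaw, lintegral_map hm (measurable_graphPath hA)]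
      _ = uniformUnit A := by
          simp [ofReal_abs_indicator_rpow hp, lintegral_indicator_one hA]
  rw [cost_eq_add hp P hX hY, hvert] at h
  have hzero : ∫⁻ ω, ENNReal.ofReal (|X ω 0 - Y ω 0| ^ p) ∂P = 0 := by
    -- The mass of `A` is finite, so a nonzero horizontal term would make the total strictly exceed
    -- it.
    by_contra hne
    exact h.not_gt (by
      rw [add_comm]; exact ENNReal.lt_add_right (measure_ne_top _ _) hne)
  rw [lintegral_eq_zero_iff (by fun_prop)] at hzero
  filter_upwards [hzero] with ω hω
  have h0 : |X ω 0 - Y ω 0| ^ p = 0 :=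
    le_antisymm (ENNReal.ofReal_eq_zero.1 hω) (by positivity)
  exact sub_eq_zero.1 (abs_eq_zero.1 ((Real.rpow_eq_zero (abs_nonneg _) hp.ne').1 h0))

/-- Cheap couplings of the typewriter laws with the limiting law do not converge almost surely. -/
lemma not_ae_tendsto_of_cost_le {Ω : Type*} [MeasurableSpace Ω] {P : Measure Ω}
    [IsProbabilityMeasure P] {p : ℝ} (hp : 0 < p) {X : Ω → Fin 2 → ℝ} {Xs : ℕ → Ω → Fin 2 → ℝ}
    (hX : Measurable X) (hXs : ∀ n, Measurable (Xs n)) (hlaw : P.map X = graphLaw ∅)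
    (hlaws : ∀ n, P.map (Xs n) = graphLaw (typewriterSet n))
    (hcost : ∀ n, cost p P (Xs n) X ≤ uniformUnit (typewriterSet n)) :
    ¬ ∀ᵐ ω ∂P, Tendsto (fun n => Xs n ω) atTop (𝓝 (X ω)) := by
  intro hlim
  have hunit : ∀ᵐ ω ∂P, X ω 0 ∈ Set.Ico (0 : ℝ) 1 := by
    have hm : MeasurableSet {x : Fin 2 → ℝ | x 0 ∈ Set.Ico (0 : ℝ) 1} :=
      measurableSet_Ico.preimage (measurable_pi_apply 0)
    refine (ae_map_iff hX.aemeasurable hm).1 ?_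
    rw [hlaw, graphLaw, ae_map_iff (measurable_graphPath .empty).aemeasurable hm]
    exact ae_restrict_mem measurableSet_Ico
  have hfst := ae_all_iff.2 fun n => ae_eq_of_cost_le hp (hXs n) hX
    (measurableSet_typewriterSet n) (hlaws n) hlaw (hcost n)
  have hsnd := ae_all_iff.2 fun n => ae_eq_indicator_of_map_eq (hXs n)
    (measurableSet_typewriterSet n) (hlaws n)
  obtain ⟨ω, h, hω, h0, h1, h2⟩ := (hlim.and (hunit.and (hfst.and (hsnd.and
    (ae_eq_indicator_of_map_eq hX .empty hlaw))))).exists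
  have ht : Tendsto (fun n => Xs n ω 1) atTop (𝓝 0) := by
    have := (tendsto_pi_nhds.1 h) 1
    rwa [h2, Set.indicator_empty] at this
  -- Convergence to `0` forces values below `1` eventually, yet the value is `1` whenever the first
  -- coordinate lies in the typewriter set.
  obtain ⟨n, hn, hlt⟩ :=
    ((frequently_mem_typewriterSet hω).and_eventually (ht.eventually_lt_const one_pos)).exists
  rw [h1 n, h0 n, Set.indicator_of_mem hn, Pi.one_apply] at hlt
  exact lt_irrefl _ hlt

/-! ### The filtered processes -/

lemma measurable_pathOf {N : ℕ} {Ω : Type*} {m : MeasurableSpace Ω} {ℱ : Filtration (Fin N) m}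
    {X : Fin N → Ω → ℝ} (hX : Adapted ℱ X) : Measurable (pathOf X) :=
  measurable_pi_lambda _ fun t => (hX t).mono (ℱ.le t) le_rfl

/-- Hoover–Keisler equivalent processes have the same law. -/
lemma HKEquiv.map_pathOf_eq {N : ℕ} {𝕏 : FilteredProcess.{u} N} {𝕐 : FilteredProcess.{v} N}
    (h : HKEquiv 𝕏 𝕐) :
    𝕏.basis.P.map (pathOf 𝕏.X) = 𝕐.basis.P.map (pathOf 𝕐.X) := by
  have hX := measurable_pathOf 𝕏.adapted
  have hY := measurable_pathOf 𝕐.adapted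
  have := Measure.isProbabilityMeasure_map (μ := 𝕏.basis.P) hX.aemeasurable
  have := Measure.isProbabilityMeasure_map (μ := 𝕐.basis.P) hY.aemeasurable
  -- Bounded continuous functions determine a finite measure, so the `base` expressions suffice.
  refine ext_of_forall_integral_eq_of_IsFiniteMeasure fun Φ => ?_
  rw [integral_map hX.aemeasurable Φ.continuous.aestronglyMeasurable,
    integral_map hY.aemeasurable Φ.continuous.aestronglyMeasurable]
  exact h (.base Φ)

/-- A σ-algebra contained in the conditioning one is conditionally independent of any other. -/
lemma condIndepGiven_of_le {Ω : Type*} {m : MeasurableSpace Ω} {μ : Measure Ω}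
    [IsFiniteMeasure μ] {m₁ m₂ m' : MeasurableSpace Ω} (h : m₁ ≤ m') (hm : m' ≤ m)
    (h₂ : m₂ ≤ m) : CondIndepGiven μ m₁ m₂ m' := by
  intro s t hs ht
  have hint : ∀ {r : Set Ω}, MeasurableSet[m] r → Integrable (r.indicator fun _ => (1 : ℝ)) μ :=
    fun hr => (integrable_const _).indicator hr
  -- The indicator of `s` is measurable for the conditioning σ-algebra, hence equals its own
  -- conditional expectation and factors out of that of the intersection.
  rw [← Set.indicator_indicator,
    condExp_of_stronglyMeasurable hm (stronglyMeasurable_const.indicator (h _ hs))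
      (hint (hm _ (h _ hs)))]
  filter_upwards [condExp_indicator (hint (h₂ _ ht)) (h _ hs)] with ω hω
  rw [hω]
  by_cases hs : ω ∈ s <;> simp [hs]

/-- The process `(U, 1_A(U))`, with `U` uniform on `[0, 1)`, and the filtration it generates,
which is constant since `U` is known at the first time. -/
noncomputable def graphProcess (A : Set ℝ) (hA : MeasurableSet A) : FilteredProcess.{0} 2 where
  basis :=
    { Ω := ℝ
      P := uniformUnit
      ℱ := Filtration.const (Fin 2) inferInstance le_rfl }
  X := fun t x => graphPath A x t
  adapted := fun t => (measurable_pi_apply t).comp (measurable_graphPath hA)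

/-- The filtrations are constant, so the terminal σ-algebra is the conditioning one and both
causality conditions are trivial. -/
lemma isBicausal_graphProcess {A B : Set ℝ} (hA : MeasurableSet A) (hB : MeasurableSet B) :
    IsBicausal (graphProcess A hA).basis (graphProcess B hB).basis
      (uniformUnit.map fun x : ℝ => (x, x)) := by
  have hd : Measurable fun x : ℝ => (x, x) := measurable_id.prodMk measurable_id
  have := Measure.isProbabilityMeasure_map (μ := uniformUnit) hd.aemeasurable
  refine ⟨⟨?_, ?_⟩, fun t => ?_, fun t => ?_⟩
  · exact (Measure.map_map measurable_fst hd).trans Measure.map_id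
  · exact (Measure.map_map measurable_snd hd).trans Measure.map_id
  · exact condIndepGiven_of_le (MeasurableSpace.comap_mono (iSup_le fun _ => le_rfl))
      measurable_fst.comap_le measurable_snd.comap_le
  · exact condIndepGiven_of_le (MeasurableSpace.comap_mono (iSup_le fun _ => le_rfl))
      measurable_snd.comap_le measurable_fst.comap_le

lemma adaptedWassersteinPow_graphProcess_le {p : ℝ} (hp : 0 < p) {A : Set ℝ}
    (hA : MeasurableSet A) :
    adaptedWassersteinPow p (graphProcess A hA) (graphProcess ∅ .empty) ≤ uniformUnit A := by
  refine (iInf₂_le _ (isBicausal_graphProcess hA .empty)).trans ?_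
  refine le_trans (le_of_eq ?_) (cost_graphPath hp hA).le
  exact cost_map p uniformUnit (measurable_id.prodMk measurable_id)
    ((measurable_graphPath hA).comp measurable_fst)
    ((measurable_graphPath .empty).comp measurable_snd)

end AdaptedTransport

theorem proposition7p8 (p : ℝ) (hp : 1 ≤ p) :
    (∃ (μ : Measure (Fin 2 → ℝ)) (μs : ℕ → Measure (Fin 2 → ℝ)),
      AdaptedTransport.MemPp p μ ∧ (∀ n, AdaptedTransport.MemPp p (μs n)) ∧
      Tendsto (fun n => AdaptedTransport.wasserstein p (μs n) μ) atTop (𝓝 0) ∧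
      ∀ (Ω : Type u) [MeasurableSpace Ω] (P : Measure Ω) [IsProbabilityMeasure P]
        (X : Ω → Fin 2 → ℝ) (Xs : ℕ → Ω → Fin 2 → ℝ),
        Measurable X → (∀ n, Measurable (Xs n)) →
        P.map X = μ → (∀ n, P.map (Xs n) = μs n) →
        ¬ ((∀ n, AdaptedTransport.cost p P (Xs n) X =
              AdaptedTransport.wassersteinPow p (μs n) μ) ∧
            ∀ᵐ ω ∂P, Tendsto (fun n => Xs n ω) atTop (𝓝 (X ω)))) ∧
    (∃ (𝕏 : AdaptedTransport.FilteredProcess.{0} 2)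
        (𝕏s : ℕ → AdaptedTransport.FilteredProcess.{0} 2),
      𝕏.HasMoment p ∧ (∀ n, (𝕏s n).HasMoment p) ∧
      Tendsto (fun n => AdaptedTransport.adaptedWasserstein p (𝕏s n) 𝕏) atTop (𝓝 0) ∧
      ∀ (B : AdaptedTransport.StochasticBasis.{u} 2)
        (X : Fin 2 → B.Ω → ℝ) (Xs : ℕ → Fin 2 → B.Ω → ℝ)
        (hX : Adapted B.ℱ X) (hXs : ∀ n, Adapted B.ℱ (Xs n)),
        (∀ n, AdaptedTransport.HKEquiv ⟨B, Xs n, hXs n⟩ (𝕏s n)) →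
        AdaptedTransport.HKEquiv ⟨B, X, hX⟩ 𝕏 →
        ¬ ((∀ n, AdaptedTransport.cost p B.P
                (AdaptedTransport.pathOf (Xs n)) (AdaptedTransport.pathOf X) =
              AdaptedTransport.adaptedWassersteinPow p (𝕏s n) 𝕏) ∧
            ∀ᵐ ω ∂B.P, ∀ t, Tendsto (fun n => Xs n t ω) atTop (𝓝 (X t ω)))) := by
  have hp0 : 0 < p := one_pos.trans_le hp
  refine ⟨⟨AdaptedTransport.graphLaw ∅,
      fun n => AdaptedTransport.graphLaw (AdaptedTransport.typewriterSet n),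
      AdaptedTransport.memPp_graphLaw hp0 .empty, fun n =>
      AdaptedTransport.memPp_graphLaw hp0 (AdaptedTransport.measurableSet_typewriterSet n), ?_, ?_⟩,
    ⟨AdaptedTransport.graphProcess ∅ .empty,
      fun n => AdaptedTransport.graphProcess _ (AdaptedTransport.measurableSet_typewriterSet n),
      AdaptedTransport.lintegral_graphPath_lt_top hp0 ∅,
      fun n => AdaptedTransport.lintegral_graphPath_lt_top hp0 _, ?_, ?_⟩⟩
  · exact AdaptedTransport.tendsto_rpow_of_le_volume_typewriterSet hp0 fun n =>
      AdaptedTransport.wassersteinPow_graphLaw_le hp0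
        (AdaptedTransport.measurableSet_typewriterSet n)
  · rintro Ω _ P _ X Xs hX hXs hlaw hlaws ⟨hcost, hlim⟩
    refine AdaptedTransport.not_ae_tendsto_of_cost_le hp0 hX hXs hlaw hlaws (fun n => ?_) hlim
    exact (hcost n).trans_le (AdaptedTransport.wassersteinPow_graphLaw_le hp0
      (AdaptedTransport.measurableSet_typewriterSet n))
  · exact AdaptedTransport.tendsto_rpow_of_le_volume_typewriterSet hp0 fun n =>
      AdaptedTransport.adaptedWassersteinPow_graphProcess_le hp0
        (AdaptedTransport.measurableSet_typewriterSet n)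
  · rintro B X Xs hX hXs hlaws hlaw ⟨hcost, hlim⟩
    -- The path law of a `graphProcess` is a `graphLaw` by definition.
    refine AdaptedTransport.not_ae_tendsto_of_cost_le hp0 (AdaptedTransport.measurable_pathOf hX)
      (fun n => AdaptedTransport.measurable_pathOf (hXs n)) hlaw.map_pathOf_eq
      (fun n => (hlaws n).map_pathOf_eq) (fun n => ?_)
      (hlim.mono fun ω h => tendsto_pi_nhds.2 h)
    exact (hcost n).trans_le (AdaptedTransport.adaptedWassersteinPow_graphProcess_le hp0
      (AdaptedTransport.measurableSet_typewriterSet n))
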